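/- Let $\mathbb{F}_4$ be the field with four elements. A quaternary $[n,k,d]$ code is a $k$-dimensional subspace $C\subseteq\mathbb{F}_4^n$ whose minimum weight $\min\{\mathrm{wt}(x) : x\in C,\ x\neq 0\}$ equals $d$, where $\mathrm{wt}(x)=|\{i : x_i\neq 0\}|$. Its Hermitian dual is $C^{\perp h}=\{x\in\mathbb{F}_4^n : \sum_{i=1}^n x_i y_i^2=0 \text{ for all } y\in C\}$, and $C$ is Hermitian LCD if $C\cap C^{\perp h}=\{0\}$. Let $d_4(n,k)$ denote the largest minimum weight of quaternary Hermitian LCD $[n,k]$ codes. There exists a quaternary Hermitian LCD $[n,k,d]$ code, and hence $d_4(n,k)\ge d$, for each of the following triples $(n,k,d)$: $$ \begin{aligned} &(14,10,3),(15,11,3),(16,12,3),(17,13,3),(26,4,17),(26,17,6),\\ &(26,19,5),(26,20,4),(27,18,6),(27,19,5),(27,20,5),(27,21,4),\\ &(28,5,17),(28,17,7),(28,19,6),(28,20,5),(28,21,5),(28,22,4),\\ &(29,5,18),(29,6,17),(29,18,7),(29,20,6),(29,21,5),(29,22,5),\\ &(29,23,4),(30,5,19),(30,16,9),(30,19,7),(30,21,6),(30,22,5),\\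 &(30,23,5) \end{aligned} $$ and $$ \begin{aligned} &(26,6,14),(26,7,13),(26,8,12),(26,12,9),(26,14,7),(26,15,7),\\ &(26,16,6),(27,4,17),(27,7,14),(27,10,11),(27,13,9),(27,14,8),\\ &(27,15,7),(27,16,7),(27,17,6),(28,7,14),(28,8,14),(28,10,12),\\ &(28,14,9),(28,15,8),(28,16,7),(28,18,6),(29,4,18),(29,7,15),\\ &(29,8,14),(29,9,14),(29,10,13),(29,15,9),(29,16,8),(29,17,7),\\ &(29,19,6),(30,4,19),(30,6,17),(30,8,15),(30,9,14),(30,10,14),\\ &(30,17,8),(30,18,7),(30,20,6) \end{aligned} $$ -/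

import Mathlib

namespace QuaternaryLCD

variable {F : Type*} [Field F] {n : ℕ}

/-- The Hermitian inner product of two vectors over a field with `q ^ 2` elements, where the
conjugate of `a` is `a ^ q`. -/
def hermInner (q : ℕ) (x y : Fin n → F) : F := ∑ i, x i * (y i) ^ q

/-- The Hermitian dual code: all `x` with `hermInner q x y = 0` for every `y ∈ C`. -/
def hermDual (q : ℕ) (C : Submodule F (Fin n → F)) : Submodule F (Fin n → F) where
  carrier := {x | ∀ y ∈ C, hermInner q x y = 0}
  zero_mem' := by
    intro y _
    simp [hermInner]
  add_mem' := by
    intro a b ha hb y hy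
    have h : hermInner q (a + b) y = hermInner q a y + hermInner q b y := by
      simp [hermInner, add_mul, Finset.sum_add_distrib]
    rw [h, ha y hy, hb y hy, add_zero]
  smul_mem' := by
    intro c x hx y hy
    have h : hermInner q (c • x) y = c * hermInner q x y := by
      simp [hermInner, Finset.mul_sum, mul_assoc]
    rw [h, hx y hy, mul_zero]

/-- A code is Hermitian LCD if it meets its Hermitian dual trivially. -/
def IsHermitianLCD (q : ℕ) (C : Submodule F (Fin n → F)) : Prop :=
  C ⊓ hermDual q C = ⊥

/-- `C` is an `[n, k, d]` code: a `k`-dimensional subspace of `Fⁿ` whose smallest weight of a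
nonzero codeword is (exactly) `d`. -/
def IsCode [DecidableEq F] (C : Submodule F (Fin n → F)) (k d : ℕ) : Prop :=
  Module.finrank F C = k ∧ IsLeast {w | ∃ x ∈ C, x ≠ 0 ∧ hammingNorm x = w} d

/-- `C` is a quaternary Hermitian LCD `[n, k, d]` code; meant for a field `F` with four elements,
in which conjugation is `a ↦ a ^ 2`. -/
def IsQuaternaryHermitianLCD [DecidableEq F] (C : Submodule F (Fin n → F)) (k d : ℕ) : Prop :=
  IsCode C k d ∧ IsHermitianLCD 2 C

variable (F) in
/-- `d₄(n, k)`: the largest minimum weight of quaternary Hermitian LCD `[n, k]` codes. The set is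
bounded by `n`, so the supremum is a maximum as soon as such a nonzero code exists. -/
noncomputable def d4 [DecidableEq F] (n k : ℕ) : ℕ :=
  sSup {d | ∃ C : Submodule F (Fin n → F), IsQuaternaryHermitianLCD C k d}

/-- The triples `(n, k, d)` in which `d` is one less than the largest minimum weight of the
`[n, k]` codes over the field with four elements that were known at the time. -/
def paramsOne : List (ℕ × ℕ × ℕ) :=
  [(14, 10, 3), (15, 11, 3), (16, 12, 3), (17, 13, 3), (26, 4, 17), (26, 17, 6),
   (26, 19, 5), (26, 20, 4), (27, 18, 6), (27, 19, 5), (27, 20, 5), (27, 21, 4),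
   (28, 5, 17), (28, 17, 7), (28, 19, 6), (28, 20, 5), (28, 21, 5), (28, 22, 4),
   (29, 5, 18), (29, 6, 17), (29, 18, 7), (29, 20, 6), (29, 21, 5), (29, 22, 5),
   (29, 23, 4), (30, 5, 19), (30, 16, 9), (30, 19, 7), (30, 21, 6), (30, 22, 5),
   (30, 23, 5)]

/-- The triples `(n, k, d)` in which `d` is two less than the largest minimum weight of the
`[n, k]` codes over the field with four elements that were known at the time. -/
def paramsTwo : List (ℕ × ℕ × ℕ) :=
  [(26, 6, 14), (26, 7, 13), (26, 8, 12), (26, 12, 9), (26, 14, 7), (26, 15, 7),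
   (26, 16, 6), (27, 4, 17), (27, 7, 14), (27, 10, 11), (27, 13, 9), (27, 14, 8),
   (27, 15, 7), (27, 16, 7), (27, 17, 6), (28, 7, 14), (28, 8, 14), (28, 10, 12),
   (28, 14, 9), (28, 15, 8), (28, 16, 7), (28, 18, 6), (29, 4, 18), (29, 7, 15),
   (29, 8, 14), (29, 9, 14), (29, 10, 13), (29, 15, 9), (29, 16, 8), (29, 17, 7),
   (29, 19, 6), (30, 4, 19), (30, 6, 17), (30, 8, 15), (30, 9, 14), (30, 10, 14),
   (30, 17, 8), (30, 18, 7), (30, 20, 6)]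

end QuaternaryLCD

/-!
Each of the codes is written down explicitly, and its three properties are verified by computation.

All of them come from twelve systematic codes `{(u, B u)}`. Keeping only some of the columns of `B`
shortens such a code, which cannot lower the minimum weight; dropping `t` rows punctures it, which
lowers the minimum weight by at most `t`; adding zero rows pads it with zero coordinates, which
changes no weight and no inner product. So a lower bound for the minimum weight of the twelve codes
bounds it for all codes derived from them, and one codeword for each derived code shows that the
bound is attained (`exists_of_check`). The Hermitian LCD property amounts to the invertibility of
the Gram matrix `1 + Bᴴ B`, or equivalently of `1 + B Bᴴ` (`isHermitianLCD_range_encode`); it is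
certified by an inverse of the smaller of the two.

The lower bound for `{(u, B u)}` says that a nonzero message `u` of weight `t` has at least `d - t`
nonzero parities. This is checked for all `u` of the same weight simultaneously: the values of one
parity at all these `u` form two long bit strings, one for each coordinate with respect to a basis
`1, ω` of the field over its prime field, and the numbers of nonzero parities are compared with
`d - t` by bitwise operations on such strings (`batch`, `manyNonzero`, `enumCheck`). Each bit string
is a single natural number, so that few arithmetic operations are needed. For codes of rate above
one half and large minimum weight there would be too many messages; there one uses that a word of
small weight has small weight on the message symbols or on the parity symbols, and enumerates
according to either (`minWeightGE_of_enumCheck_of_enumCheck`).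
-/

namespace QuaternaryLCD

/-! ### The field with four elements in coordinates -/

section Coordinates

variable {F : Type*} [Field F]

/-- The element `a + bω`, where the bits `a` and `b` stand for elements of the prime field. -/
def scalar (ω : F) (a b : Bool) : F := (if a then 1 else 0) + if b then ω else 0

/-- `ω` is an element of order three of a field with four elements, so that `1, ω` is a basis of
the field over its prime field. -/
structure IsOmega (ω : F) : Prop where
  one_add_one : (1 : F) + 1 = 0
  mul_self : ω * ω = ω + 1
  exists_scalar : ∀ x : F, ∃ a b, scalar ω a b = x

/-- A vector over the field with four elements, packed into two numbers: the `j`-th entry is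
`a + bω` with `a` and `b` the bits of index `j`. -/
abbrev Packed := ℕ × ℕ

/-- The `j`-th entry of a packed vector. -/
def Packed.entry (ω : F) (v : Packed) (j : ℕ) : F := scalar ω (v.1.testBit j) (v.2.testBit j)

namespace IsOmega

variable {ω : F}

theorem add_self (hω : IsOmega ω) (x : F) : x + x = 0 := by
  rw [← one_mul x, ← add_mul, hω.one_add_one, zero_mul]

theorem eq_of_add_eq_zero (hω : IsOmega ω) {x y : F} (h : x + y = 0) : x = y := by
  linear_combination h - hω.add_self y

theorem ne_zero (hω : IsOmega ω) : ω ≠ 0 := by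
  rintro rfl
  simpa using hω.mul_self

theorem ne_one (hω : IsOmega ω) : ω ≠ 1 := by
  rintro rfl
  have h := hω.mul_self
  rw [hω.one_add_one, mul_one] at h
  exact one_ne_zero h

theorem scalar_xor (hω : IsOmega ω) (a b c d : Bool) :
    scalar ω (a ^^ c) (b ^^ d) = scalar ω a b + scalar ω c d := by
  have h1 := hω.one_add_one
  have h2 := hω.add_self ω
  cases a <;> cases b <;> cases c <;> cases d <;> simp [scalar] <;> grind

theorem scalar_mul (hω : IsOmega ω) (a b c d : Bool) :
    scalar ω ((a && c) ^^ (b && d)) ((a && d) ^^ (b && c) ^^ (b && d)) =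
      scalar ω a b * scalar ω c d := by
  have h1 := hω.one_add_one
  have h2 := hω.mul_self
  cases a <;> cases b <;> cases c <;> cases d <;> simp [scalar] <;> grind

theorem scalar_conj (hω : IsOmega ω) (a b : Bool) : scalar ω (a ^^ b) b = scalar ω a b ^ 2 := by
  rw [sq, ← hω.scalar_mul]
  cases a <;> cases b <;> rfl

theorem scalar_eq_zero (hω : IsOmega ω) {a b : Bool} : scalar ω a b = 0 ↔ (a || b) = false := by
  have h1 := hω.ne_zero
  have h2 := hω.ne_one
  have h3 : (1 : F) + ω ≠ 0 := fun h => h2 (hω.eq_of_add_eq_zero h).symm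
  cases a <;> cases b <;> simp [scalar, *]

end IsOmega

theorem exists_isOmega [Fintype F] (hF : Fintype.card F = 4) : ∃ ω : F, IsOmega ω := by
  classical
  obtain ⟨ω, -, hω⟩ : ∃ ω ∈ (Finset.univ : Finset F), ω ∉ ({0, 1} : Finset F) := by
    apply Finset.exists_mem_notMem_of_card_lt_card
    rw [Finset.card_univ, hF]
    exact lt_of_le_of_lt Finset.card_le_two (by norm_num)
  simp only [Finset.mem_insert, Finset.mem_singleton, not_or] at hω
  have h4 : (1 : F) + 1 = 0 := by
    have h : ((4 : ℕ) : F) = 0 := hF ▸ Nat.cast_card_eq_zero F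
    have : ((1 : F) + 1) ^ 2 = 0 := by push_cast at h; linear_combination h
    exact pow_eq_zero_iff (two_ne_zero) |>.1 this
  have hp : ω ^ 4 = ω := hF ▸ FiniteField.pow_card ω
  have hsq : ω * ω = ω + 1 := by
    have h : (ω * (ω - 1)) * (ω * ω + ω + 1) = 0 := by linear_combination hp
    have h' := (mul_eq_zero.1 h).resolve_left (mul_ne_zero hω.1 (sub_ne_zero.2 hω.2))
    linear_combination h' - (ω + 1) * h4
  refine ⟨ω, h4, hsq, ?_⟩
  have hinj : Function.Injective fun p : Bool × Bool => scalar ω p.1 p.2 := by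
    rintro ⟨a, b⟩ ⟨c, d⟩ h
    have h1 := hω.1
    have h2 := hω.2
    revert h
    cases a <;> cases b <;> cases c <;> cases d <;> simp [scalar] <;> grind
  have hbij := (Fintype.bijective_iff_injective_and_card _).2 ⟨hinj, by simp [hF]⟩
  intro x
  obtain ⟨p, hp⟩ := hbij.2 x
  exact ⟨p.1, p.2, hp⟩

/-! ### Linear algebra with packed vectors -/

namespace Packed

/-- The sum of two packed vectors. -/
def add (v w : Packed) : Packed := (v.1 ^^^ w.1, v.2 ^^^ w.2)

/-- The multiple of a packed vector by the scalar `a + bω`. -/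
def smul (a b : Bool) (v : Packed) : Packed :=
  (cond a v.1 0 ^^^ cond b v.2 0, cond a v.2 0 ^^^ cond b (v.1 ^^^ v.2) 0)

/-- The entrywise conjugate of a packed vector. -/
def conj (v : Packed) : Packed := (v.1 ^^^ v.2, v.2)

/-- The `i`-th unit vector. -/
def unit (i : ℕ) : Packed := (1 <<< i, 0)

/-- The linear combination of a list of packed vectors whose coefficients are the entries of the
packed vector `c`. -/
def comb (c : Packed) : List Packed → Packed
  | [] => (0, 0)
  | v :: vs => add (smul (c.1.testBit 0) (c.2.testBit 0) v) (comb (c.1 / 2, c.2 / 2) vs)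

/-- The `j`-th column of the matrix whose rows are the packed vectors of a list. -/
def column (j : ℕ) : List Packed → Packed
  | [] => (0, 0)
  | v :: vs => (Nat.bit (v.1.testBit j) (column j vs).1, Nat.bit (v.2.testBit j) (column j vs).2)

/-- The `i`-th vector of a list, or zero if the list is too short. -/
def row (L : List Packed) (i : ℕ) : Packed := L.getD i (0, 0)

variable {ω : F}

@[simp] theorem entry_zero (j : ℕ) : entry ω (0, 0) j = 0 := by simp [entry, scalar]

theorem entry_add (hω : IsOmega ω) (v w : Packed) (j : ℕ) :
    entry ω (add v w) j = entry ω v j + entry ω w j := by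
  simp [entry, add, hω.scalar_xor]

theorem entry_smul (hω : IsOmega ω) (a b : Bool) (v : Packed) (j : ℕ) :
    entry ω (smul a b v) j = scalar ω a b * entry ω v j := by
  rw [entry, entry, ← hω.scalar_mul]
  cases a <;> cases b <;> cases h1 : v.1.testBit j <;> cases h2 : v.2.testBit j <;>
    simp [smul, h1, h2]

theorem entry_conj (hω : IsOmega ω) (v : Packed) (j : ℕ) :
    entry ω (conj v) j = entry ω v j ^ 2 := by
  simp [entry, conj, ← hω.scalar_conj]

theorem entry_unit (i j : ℕ) : entry ω (unit i) j = if i = j then 1 else 0 := by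
  simp [entry, unit, scalar, Nat.one_shiftLeft, Nat.testBit_two_pow]

theorem entry_comb (hω : IsOmega ω) (c : Packed) (L : List Packed) (j : ℕ) :
    entry ω (comb c L) j = ∑ i ∈ Finset.range L.length, entry ω c i * entry ω (row L i) j := by
  induction L generalizing c with
  | nil => simp [comb]
  | cons v vs ih =>
    rw [comb, entry_add hω, entry_smul hω, ih, List.length_cons, Finset.sum_range_succ', add_comm]
    simp [entry, row, Nat.testBit_succ]

theorem entry_column (L : List Packed) (i j : ℕ) :
    entry ω (column j L) i = entry ω (row L i) j := by
  induction L generalizing i with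
  | nil => simp [column, row]
  | cons v vs ih =>
    cases i with
    | zero => simp [column, row, entry]
    | succ i => simpa [column, row, entry, Nat.testBit_bit_succ] using ih i

end Packed

end Coordinates

/-! ### Systematic codes -/

section Systematic

variable {F : Type*} [Field F] {n k r : ℕ}

/-- The encoder `u ↦ (u, B u)`, with its coordinates arranged along `Fin n` by `e`. -/
def encode (B : Matrix (Fin r) (Fin k) F) (e : Fin n ≃ Fin k ⊕ Fin r) :
    (Fin k → F) →ₗ[F] (Fin n → F) where
  toFun u i := Sum.elim u (B.mulVec u) (e i)
  map_add' u v := by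
    ext i
    cases h : e i <;> simp [h, Matrix.mulVec_add]
  map_smul' c u := by
    ext i
    cases h : e i <;> simp [h, Matrix.mulVec_smul]

variable (B : Matrix (Fin r) (Fin k) F) (e : Fin n ≃ Fin k ⊕ Fin r)

theorem encode_apply (u : Fin k → F) (i : Fin n) :
    encode B e u i = Sum.elim u (B.mulVec u) (e i) := rfl

theorem encode_injective : Function.Injective (encode B e) := by
  intro u v h
  ext j
  simpa [encode_apply] using congrFun h (e.symm (Sum.inl j))

theorem hammingNorm_encode [DecidableEq F] (u : Fin k → F) :
    hammingNorm (encode B e u) = hammingNorm u + hammingNorm (B.mulVec u) := by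
  have h : hammingNorm (encode B e u) = ∑ i, if Sum.elim u (B.mulVec u) (e i) ≠ 0 then 1 else 0 :=
    Finset.card_filter _ _
  rw [h, Equiv.sum_comp e fun x => if Sum.elim u (B.mulVec u) x ≠ 0 then 1 else 0,
    Fintype.sum_sum_type]
  simp only [hammingNorm, Finset.card_filter, Sum.elim_inl, Sum.elim_inr]
  rfl

theorem hermInner_encode (u v : Fin k → F) :
    hermInner 2 (encode B e u) (encode B e v) =
      ∑ j, u j * v j ^ 2 + ∑ i, B.mulVec u i * B.mulVec v i ^ 2 := by
  simp only [hermInner, encode_apply]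
  rw [Equiv.sum_comp e fun x => Sum.elim u (B.mulVec u) x * Sum.elim v (B.mulVec v) x ^ 2,
    Fintype.sum_sum_type]
  rfl

/-- The codeword of `u` is Hermitian orthogonal to the generators `(eⱼ, B eⱼ)` only if
`u = -Bᴴ B u`, where `Bᴴ` is the conjugate transpose. -/
theorem add_conjTranspose_mulVec_eq_zero {u : Fin k → F}
    (hu : encode B e u ∈ hermDual 2 (LinearMap.range (encode B e))) :
    u + (B.map (· ^ 2)).transpose.mulVec (B.mulVec u) = 0 := by
  ext j
  have h := hu _ ⟨Pi.single j 1, rfl⟩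
  rw [hermInner_encode] at h
  change u j + ∑ i, B i j ^ 2 * B.mulVec u i = 0
  simpa [Pi.single_apply, ite_pow, mul_comm] using h

theorem eq_zero_of_mul_eq_one {m : ℕ} {M N : Matrix (Fin m) (Fin m) F} (h : M * N = 1)
    {x : Fin m → F} (hx : M.transpose.mulVec x = 0) : x = 0 := by
  have h' : N.transpose * M.transpose = 1 := by rw [← Matrix.transpose_mul, h, Matrix.transpose_one]
  rw [← Matrix.one_mulVec x, ← h', ← Matrix.mulVec_mulVec, hx, Matrix.mulVec_zero]

/-- The code is LCD if one of the Gram matrices `1 + Bᴴ B` and `1 + B Bᴴ` (here transposed) is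
invertible. The second is the Gram matrix of the dual code; either may be the smaller one. -/
theorem isHermitianLCD_range_encode
    (h : (∃ N, (1 + B.transpose * B.map (· ^ 2)) * N = 1) ∨
      ∃ N, (1 + B.map (· ^ 2) * B.transpose) * N = 1) :
    IsHermitianLCD 2 (LinearMap.range (encode B e)) := by
  rw [IsHermitianLCD, eq_bot_iff]
  rintro _ ⟨⟨u, rfl⟩, hu⟩
  have key := add_conjTranspose_mulVec_eq_zero B e hu
  suffices hu0 : u = 0 by simp [hu0]
  obtain ⟨N, hN⟩ | ⟨N, hN⟩ := h
  · refine eq_zero_of_mul_eq_one hN ?_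
    simpa [Matrix.transpose_add, Matrix.transpose_mul, Matrix.add_mulVec] using key
  · have hB : B.mulVec u = 0 := by
      refine eq_zero_of_mul_eq_one hN ?_
      rw [Matrix.transpose_add, Matrix.transpose_one, Matrix.transpose_mul,
        Matrix.transpose_transpose, Matrix.add_mulVec, Matrix.one_mulVec, ← Matrix.mulVec_mulVec,
        ← Matrix.mulVec_add, key, Matrix.mulVec_zero]
    simpa [hB] using key

theorem isQuaternaryHermitianLCD_range_encode [DecidableEq F] {d : ℕ}
    (hd : ∀ u, u ≠ 0 → d ≤ hammingNorm u + hammingNorm (B.mulVec u))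
    (hw : ∃ u, u ≠ 0 ∧ hammingNorm u + hammingNorm (B.mulVec u) = d)
    (h : (∃ N, (1 + B.transpose * B.map (· ^ 2)) * N = 1) ∨
      ∃ N, (1 + B.map (· ^ 2) * B.transpose) * N = 1) :
    IsQuaternaryHermitianLCD (LinearMap.range (encode B e)) k d := by
  refine ⟨⟨?_, ?_, ?_⟩, isHermitianLCD_range_encode B e h⟩
  · rw [LinearMap.finrank_range_of_inj (encode_injective B e), Module.finrank_fin_fun]
  · obtain ⟨u, hu, rfl⟩ := hw
    exact ⟨_, ⟨u, rfl⟩, (map_ne_zero_iff _ (encode_injective B e)).2 hu, hammingNorm_encode B e u⟩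
  · rintro _ ⟨_, ⟨u, rfl⟩, hu, rfl⟩
    rw [hammingNorm_encode]
    exact hd u fun h => hu (by rw [h, map_zero])

theorem le_d4 [DecidableEq F] {d : ℕ} {C : Submodule F (Fin n → F)}
    (hC : IsQuaternaryHermitianLCD C k d) : d ≤ d4 F n k := by
  refine le_csSup ⟨n, ?_⟩ ⟨C, hC⟩
  rintro _ ⟨C', hC'⟩
  obtain ⟨x, -, -, rfl⟩ := hC'.1.2.1
  simpa using hammingNorm_le_card_fintype (x := x)

end Systematic

/-! ### Enumerating messages by weight, all at once -/

/-- A list of `size` elements `a + bω`, stored as two numbers: the bits of index `j` in `lo` and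
`hi` are the `a` and the `b` of the `j`-th element. -/
structure Batch where
  size : ℕ
  lo : ℕ
  hi : ℕ

/-- The concatenation of an `M`-bit string `x` and a bit string `y`. -/
def append (M x y : ℕ) : ℕ := x + y <<< M

/-- The `N`-bit string `x`, complemented if `c` is true. -/
def flipBits (N : ℕ) (c : Bool) (x : ℕ) : ℕ := cond c (x ^^^ (1 <<< N - 1)) x

/-- The bit string `x` followed by the three copies `y ^^ a`, `y ^^ b`, `y ^^ c` of `y`. -/
def spread (M N : ℕ) (a b c : Bool) (x y : ℕ) : ℕ :=
  append M x (append N (flipBits N a y) (append N (flipBits N b y) (flipBits N c y)))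

namespace Batch

/-- The batch `X` followed by the three translates of the batch `Y` by `x`, `ωx` and `(1 + ω)x`,
where `x = a + bω`. -/
def combine (a b : Bool) (X Y : Batch) : Batch :=
  ⟨X.size + 3 * Y.size, spread X.size Y.size a b (a ^^ b) X.lo Y.lo,
    spread X.size Y.size b (a ^^ b) a X.hi Y.hi⟩

/-- The bit string that marks the nonzero elements of a batch. -/
def support (b : Batch) : ℕ := b.lo ||| b.hi

end Batch

/-- The values `∑ j < k, v j * u j` for all `u` that have exactly `t` nonzero entries at the
positions from `s` on; the entries at the positions below `s` are arbitrary. The order of the `u`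
depends only on `s`, `k` and `t`, and starts with `u = 0` if `t = 0`. -/
def batch (v : Packed) (s : ℕ) : ℕ → ℕ → Batch
  | 0, 0 => ⟨1, 0, 0⟩
  | 0, _ + 1 => ⟨0, 0, 0⟩
  | k + 1, 0 =>
    cond (Nat.blt k s)
      (Batch.combine (v.1.testBit k) (v.2.testBit k) (batch v s k 0) (batch v s k 0))
      (batch v s k 0)
  | k + 1, t + 1 =>
    Batch.combine (v.1.testBit k) (v.2.testBit k) (batch v s k (t + 1))
      (cond (Nat.blt k s) (batch v s k (t + 1)) (batch v s k t))

/-- The bit string that marks those `u` in the order of `batch` for which more than `m` of the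
values at the vectors of a list are nonzero. -/
def manyNonzero (s k t : ℕ) : List Packed → ℕ → ℕ
  | [], _ => 0
  | v :: vs, 0 => manyNonzero s k t vs 0 ||| (batch v s k t).support
  | v :: vs, m + 1 =>
    manyNonzero s k t vs (m + 1) ||| ((batch v s k t).support &&& manyNonzero s k t vs m)

/-- For each `t ≤ w`, each nonzero `u` enumerated by `batch` has at least `d - t` nonzero values
at the vectors of the list `L`. -/
def enumCheck (L : List Packed) (s w k d : ℕ) : Bool :=
  (List.range (w + 1)).all fun t =>
    -- The zero message is the one with index `0` for `t = 0`; the bit `0 ^ t` exempts it.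
    Nat.beq (manyNonzero s k t L (d - t - 1) ||| 0 ^ t) (1 <<< (batch (0, 0) s k t).size - 1)

section BitStrings

theorem append_lt {M N x y : ℕ} (hx : x < 2 ^ M) (hy : y < 2 ^ N) :
    append M x y < 2 ^ (M + N) := by
  rw [append, Nat.shiftLeft_eq, pow_add]
  nlinarith [Nat.mul_le_mul_right (2 ^ M) (Nat.succ_le_of_lt hy)]

theorem testBit_append_left {M x j : ℕ} (hx : x < 2 ^ M) (y : ℕ) (hj : j < M) :
    (append M x y).testBit j = x.testBit j := by
  rw [append, Nat.shiftLeft_eq, add_comm, mul_comm, Nat.testBit_two_pow_mul_add _ hx, if_pos hj]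

theorem testBit_append_right {M x : ℕ} (hx : x < 2 ^ M) (y j : ℕ) :
    (append M x y).testBit (M + j) = y.testBit j := by
  rw [append, Nat.shiftLeft_eq, add_comm, mul_comm, Nat.testBit_two_pow_mul_add _ hx,
    if_neg (by omega), Nat.add_sub_cancel_left]

theorem flipBits_lt {N x : ℕ} (c : Bool) (hx : x < 2 ^ N) : flipBits N c x < 2 ^ N := by
  cases c
  · exact hx
  · rw [flipBits, Nat.one_shiftLeft]
    exact Nat.xor_lt_two_pow hx (Nat.sub_lt (by positivity) one_pos)

theorem testBit_flipBits {N j : ℕ} (c : Bool) (x : ℕ) (hj : j < N) :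
    (flipBits N c x).testBit j = (x.testBit j ^^ c) := by
  cases c <;> simp [flipBits, Nat.one_shiftLeft, Nat.testBit_two_pow_sub_one, hj]

end BitStrings

namespace Batch

variable {F : Type*} [Field F] {ω : F}

/-- The bit strings of the batch are no longer than its size. -/
def WellFormed (b : Batch) : Prop := b.lo < 2 ^ b.size ∧ b.hi < 2 ^ b.size

/-- The `j`-th element of a batch. -/
def value (ω : F) (b : Batch) (j : ℕ) : F := scalar ω (b.lo.testBit j) (b.hi.testBit j)

theorem value_ne_zero (hω : IsOmega ω) (b : Batch) (j : ℕ) :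
    b.value ω j ≠ 0 ↔ b.support.testBit j = true := by
  rw [value, Ne, hω.scalar_eq_zero, support, Nat.testBit_or, Bool.not_eq_false]

variable {X Y : Batch}

theorem WellFormed.combine (hX : X.WellFormed) (hY : Y.WellFormed) (a b : Bool) :
    (combine a b X Y).WellFormed := by
  have h : (Batch.combine a b X Y).size = X.size + (Y.size + (Y.size + Y.size)) := by
    simp only [Batch.combine]; ring
  constructor <;> rw [h]
  · exact append_lt hX.1 (append_lt (flipBits_lt _ hY.1)
      (append_lt (flipBits_lt _ hY.1) (flipBits_lt _ hY.1)))
  · exact append_lt hX.2 (append_lt (flipBits_lt _ hY.2)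
      (append_lt (flipBits_lt _ hY.2) (flipBits_lt _ hY.2)))

theorem value_combine_left (hX : X.WellFormed) (a b : Bool) {j : ℕ} (hj : j < X.size) :
    (combine a b X Y).value ω j = X.value ω j := by
  simp only [value, combine, spread, testBit_append_left hX.1 _ hj, testBit_append_left hX.2 _ hj]

/-- The multiple by `p + qω ≠ 0` of the translation sits in the copy of `Y` with this number. -/
def copyIndex (p q : Bool) : ℕ := cond q (cond p 2 1) 0

theorem value_combine_right (hω : IsOmega ω) (hX : X.WellFormed) (hY : Y.WellFormed) (a b : Bool)
    {p q : Bool} (hpq : (p || q) = true) {j : ℕ} (hj : j < Y.size) :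
    (combine a b X Y).value ω (X.size + (copyIndex p q * Y.size + j)) =
      Y.value ω j + scalar ω a b * scalar ω p q := by
  have l1 := fun c => flipBits_lt c hY.1
  have l2 := fun c => flipBits_lt c hY.2
  rw [← hω.scalar_mul, value, value, ← hω.scalar_xor]
  simp only [combine, spread, testBit_append_right hX.1, testBit_append_right hX.2]
  obtain ⟨rfl, rfl⟩ | ⟨rfl, rfl⟩ | ⟨rfl, rfl⟩ :
      p = true ∧ q = false ∨ p = false ∧ q = true ∨ p = true ∧ q = true := by
    revert hpq; cases p <;> cases q <;> simp
  · simp [copyIndex, testBit_append_left (l1 _) _ hj, testBit_append_left (l2 _) _ hj,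
      testBit_flipBits _ _ hj]
  · simp [copyIndex, testBit_append_left (l1 _) _ hj, testBit_append_left (l2 _) _ hj,
      testBit_append_right (l1 _), testBit_append_right (l2 _), testBit_flipBits _ _ hj]
  · simp [copyIndex, two_mul, add_assoc, testBit_append_right (l1 _), testBit_append_right (l2 _),
      testBit_flipBits _ _ hj]

theorem index_lt_size_combine (a b p q : Bool) {j : ℕ} (hj : j < Y.size) :
    X.size + (copyIndex p q * Y.size + j) < (combine a b X Y).size := by
  have : copyIndex p q ≤ 2 := by cases p <;> cases q <;> decide
  have := Nat.mul_le_mul_right Y.size this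
  simp only [combine]
  omega

end Batch

theorem wellFormed_batch (v : Packed) (s k t : ℕ) : (batch v s k t).WellFormed := by
  induction k generalizing t with
  | zero => cases t <;> simp [batch, Batch.WellFormed]
  | succ k ih =>
    cases t <;> rw [batch] <;> cases Nat.blt k s
    · exact ih 0
    · exact (ih 0).combine (ih 0) _ _
    · exact (ih _).combine (ih _) _ _
    · exact (ih _).combine (ih _) _ _

theorem size_batch (v v' : Packed) (s k t : ℕ) : (batch v s k t).size = (batch v' s k t).size := by
  induction k generalizing t with
  | zero => cases t <;> rfl
  | succ k ih =>
    cases t <;> simp only [batch] <;> cases Nat.blt k s <;>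
      simp only [cond_true, cond_false, Batch.combine, ih _]

section Soundness

variable {F : Type*} [Field F] [DecidableEq F] {ω : F}

/-- The number of nonzero values among `x 0, …, x (n - 1)`. -/
def weight (n : ℕ) (x : ℕ → F) : ℕ := Nat.count (fun i => x i ≠ 0) n

/-- The number of nonzero values among `x s, …, x (n - 1)`. -/
def weightFrom (s n : ℕ) (x : ℕ → F) : ℕ := Nat.count (fun i => s ≤ i ∧ x i ≠ 0) n

/-- The product of the packed vector `v` and the first `k` entries of `u`. -/
def dot (ω : F) (v : Packed) (k : ℕ) (u : ℕ → F) : F := ∑ j ∈ Finset.range k, v.entry ω j * u j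

/-- Every message of the right weight is enumerated, at an index that does not depend on the vector
`v` with which it is multiplied. -/
theorem exists_index (hω : IsOmega ω) (s k : ℕ) (u : ℕ → F) :
    ∃ j, (∀ v, j < (batch v s k (weightFrom s k u)).size ∧
      (batch v s k (weightFrom s k u)).value ω j = dot ω v k u) ∧
      (weightFrom s k u = 0 → (∃ i < k, u i ≠ 0) → j ≠ 0) := by
  induction k with
  | zero => exact ⟨0, fun v => by simp [weightFrom, batch, Batch.value, dot, scalar], by simp⟩
  | succ k ih =>
    obtain ⟨j, hj, hj0⟩ := ih
    have hdot : ∀ v, dot ω v (k + 1) u = dot ω v k u + v.entry ω k * u k := fun v =>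
      Finset.sum_range_succ _ _
    have hw : weightFrom s (k + 1) u = weightFrom s k u + if s ≤ k ∧ u k ≠ 0 then 1 else 0 :=
      Nat.count_succ _ _
    by_cases hu : u k = 0
    · -- The messages that end in `0` come first.
      rw [if_neg (by simp [hu]), add_zero] at hw
      refine ⟨j, fun v => ?_, fun h0 ⟨i, hi, hui⟩ => hj0 (hw ▸ h0) ⟨i, ?_, hui⟩⟩
      · have hwf := wellFormed_batch v s k (weightFrom s k u)
        rw [hw, hdot, hu, mul_zero, add_zero, ← (hj v).2]
        have hjv := (hj v).1
        generalize weightFrom s k u = t at hjv hwf ⊢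
        have aux : ∀ a b Y, j < (Batch.combine a b (batch v s k t) Y).size ∧
            (Batch.combine a b (batch v s k t) Y).value ω j = (batch v s k t).value ω j :=
          fun a b Y => ⟨Nat.lt_add_right _ hjv, Batch.value_combine_left hwf a b hjv⟩
        cases t <;> rw [batch]
        · cases Nat.blt k s
          · exact ⟨hjv, rfl⟩
          · exact aux _ _ _
        · exact aux _ _ _
      · exact lt_of_le_of_ne (Nat.lt_succ_iff.1 hi) fun h => hui (h ▸ hu)
    · obtain ⟨p, q, hpq⟩ := hω.exists_scalar (u k)
      have hpq' : (p || q) = true := by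
        rw [← Bool.not_eq_false, ← hω.scalar_eq_zero, hpq]
        exact hu
      by_cases hk : k < s
      · rw [if_neg (by omega), add_zero] at hw
        have hb : ∀ v t, batch v s (k + 1) t = Batch.combine (v.1.testBit k) (v.2.testBit k)
            (batch v s k t) (batch v s k t) := by
          have : Nat.blt k s = true := by simpa [Nat.blt] using hk
          intro v t
          cases t <;> simp [batch, this]
        refine ⟨(batch (0, 0) s k (weightFrom s k u)).size +
          (Batch.copyIndex p q * (batch (0, 0) s k (weightFrom s k u)).size + j),
          fun v => ?_, fun _ _ => ?_⟩
        · have hwf := wellFormed_batch v s k (weightFrom s k u)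
          rw [hw, hb, size_batch (0, 0) v, Batch.value_combine_right hω hwf hwf _ _ hpq' (hj v).1,
            hdot, (hj v).2, hpq]
          exact ⟨Batch.index_lt_size_combine _ _ _ _ (hj v).1, rfl⟩
        · have := (hj (0, 0)).1
          omega
      · rw [if_pos ⟨by omega, hu⟩] at hw
        have hb : ∀ v t, batch v s (k + 1) (t + 1) = Batch.combine (v.1.testBit k) (v.2.testBit k)
            (batch v s k (t + 1)) (batch v s k t) := by
          have : Nat.blt k s = false := by rw [Nat.blt, ← Bool.not_eq_true, Nat.ble_eq]; omega
          intro v t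
          simp [batch, this]
        refine ⟨(batch (0, 0) s k (weightFrom s k u + 1)).size +
          (Batch.copyIndex p q * (batch (0, 0) s k (weightFrom s k u)).size + j),
          fun v => ?_, fun h => ?_⟩
        · rw [hw, hb, size_batch (0, 0) v, size_batch (0, 0) v,
            Batch.value_combine_right hω (wellFormed_batch v s k _) (wellFormed_batch v s k _) _ _
              hpq' (hj v).1, hdot, (hj v).2, hpq]
          exact ⟨Batch.index_lt_size_combine _ _ _ _ (hj v).1, rfl⟩
        · omega

theorem lt_weight_of_testBit_manyNonzero (hω : IsOmega ω) {s k t j : ℕ} (L : List Packed) (m : ℕ)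
    (h : (manyNonzero s k t L m).testBit j = true) :
    m < weight L.length fun i => (batch (Packed.row L i) s k t).value ω j := by
  induction L generalizing m with
  | nil => simp [manyNonzero] at h
  | cons v vs ih =>
    have hw : (weight (v :: vs).length fun i => (batch (Packed.row (v :: vs) i) s k t).value ω j) =
        (weight vs.length fun i => (batch (Packed.row vs i) s k t).value ω j) +
          if (batch v s k t).value ω j ≠ 0 then 1 else 0 := by
      simp only [weight, List.length_cons, Nat.count_succ']
      rfl
    rw [hw]
    simp only [Batch.value_ne_zero hω]
    cases m with
    | zero =>
      rw [manyNonzero, Nat.testBit_or, Bool.or_eq_true] at h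
      rcases h with h | h
      · exact Nat.lt_add_right _ (ih _ h)
      · simp [h]
    | succ m =>
      rw [manyNonzero, Nat.testBit_or, Nat.testBit_and, Bool.or_eq_true, Bool.and_eq_true] at h
      rcases h with h | ⟨h, h'⟩
      · exact Nat.lt_add_right _ (ih _ h)
      · rw [if_pos h]
        exact Nat.succ_lt_succ (ih _ h')

theorem le_weight_of_enumCheck (hω : IsOmega ω) {L : List Packed} {s w k d : ℕ}
    (h : enumCheck L s w k d = true) {u : ℕ → F} (hu : ∃ i < k, u i ≠ 0)
    (hw : weightFrom s k u ≤ w) :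
    d ≤ weightFrom s k u + weight L.length fun i => dot ω (Packed.row L i) k u := by
  obtain ⟨j, hj, hj0⟩ := exists_index hω s k u
  have ht := List.all_eq_true.1 h _ (List.mem_range.2 (Nat.lt_succ_of_le hw))
  have hbit := congrArg (fun x => x.testBit j) (Nat.eq_of_beq_eq_true ht)
  simp only [Nat.one_shiftLeft, Nat.testBit_two_pow_sub_one, Nat.testBit_or,
    decide_eq_true (hj (0, 0)).1] at hbit
  have hzero : (0 ^ weightFrom s k u).testBit j = false := by
    rcases Nat.eq_zero_or_pos (weightFrom s k u) with h0 | h0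
    · rw [h0, pow_zero, ← Bool.not_eq_true, Nat.testBit_one_eq_true_iff_self_eq_zero]
      exact hj0 h0 hu
    · simp [zero_pow h0.ne']
  rw [hzero, Bool.or_false] at hbit
  have := lt_weight_of_testBit_manyNonzero hω L _ hbit
  simp only [(hj _).2] at this
  omega

end Soundness

/-! ### Lower bounds for the minimum weight -/

section MinWeight

variable {F : Type*} [Field F] {ω : F}

/-- If every unit vector `eᵢ` is the combination of the rows of `L` with the coefficients in the
`i`-th row of `Q`, then `Q` recovers a message from its products with the rows of `L`. -/
theorem dot_dot (hω : IsOmega ω) {Q L : List Packed} {k : ℕ}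
    (h : ((List.range k).all fun i => decide ((Packed.row Q i).comb L = Packed.unit i)) = true)
    (u : ℕ → F) {i : ℕ} (hi : i < k) :
    dot ω (Packed.row Q i) L.length (fun l => dot ω (Packed.row L l) k u) = u i := by
  have hi' := of_decide_eq_true (List.all_eq_true.1 h i (List.mem_range.2 hi))
  simp only [dot, Finset.mul_sum, ← mul_assoc]
  rw [Finset.sum_comm]
  simp only [← Finset.sum_mul, ← Packed.entry_comb hω, hi', Packed.entry_unit, ite_mul, one_mul,
    zero_mul, Finset.sum_ite_eq, Finset.mem_range, hi, if_true]

variable [DecidableEq F]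

/-- The systematic code `{(u, B u)}`, where `B` has the rows `L` and `k` columns, has minimum
weight at least `d`. -/
def MinWeightGE (ω : F) (L : List Packed) (k d : ℕ) : Prop :=
  ∀ u : ℕ → F, (∃ i < k, u i ≠ 0) →
    d ≤ weight k u + weight L.length fun i => dot ω (Packed.row L i) k u

theorem weight_congr {n : ℕ} {x y : ℕ → F} (h : ∀ i < n, x i = y i) : weight n x = weight n y := by
  simp only [weight, Nat.count_eq_card_filter_range]
  congr 1
  exact Finset.filter_congr fun i hi => by rw [h i (Finset.mem_range.1 hi)]

theorem minWeightGE_of_enumCheck (hω : IsOmega ω) {L : List Packed} {k d : ℕ}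
    (h : enumCheck L 0 (d - 1) k d = true) : MinWeightGE ω L k d := by
  intro u hu
  have h0 : weightFrom 0 k u = weight k u := by simp [weightFrom, weight]
  rcases Nat.lt_or_ge (weight k u) d with hlt | hge
  · have := le_weight_of_enumCheck hω h hu (by omega)
    rwa [h0] at this
  · exact Nat.le_add_right_of_le hge

theorem weight_add (m n : ℕ) (x : ℕ → F) :
    weight (m + n) x = weight m x + weight n fun i => x (m + i) :=
  Nat.count_add _ _ _

theorem weightFrom_add (s n : ℕ) (x : ℕ → F) :
    weightFrom s (s + n) x = weight n fun i => x (s + i) := by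
  have h : Nat.count (fun i => s ≤ i ∧ x i ≠ 0) s = 0 := by
    rw [Nat.count_eq_card_filter_range, Finset.card_eq_zero, Finset.filter_eq_empty_iff]
    intro i hi h
    exact absurd h.1 (not_le.2 (Finset.mem_range.1 hi))
  rw [weightFrom, Nat.count_add, h, zero_add, weight]
  simp

/-- The parities `B u` and the first `s` entries of the message `u` form a second information
set, with encoder `Q`. A word of weight less than `d` has at most `w` nonzero entries in the message
or at most `d - 2 - w` in the parities, so these words are found by two short enumerations. -/
theorem minWeightGE_of_enumCheck_of_enumCheck (hω : IsOmega ω) {L Q : List Packed} {k d s w : ℕ}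
    (hQ : Q.length = k) (h1 : enumCheck L 0 w k d = true)
    (h2 : enumCheck Q s (d - 2 - w) (s + L.length) d = true)
    (h : ((List.range k).all fun i => decide ((Packed.row Q i).comb
      ((List.range s).map Packed.unit ++ L) = Packed.unit i)) = true) :
    MinWeightGE ω L k d := by
  intro u hu
  have h0 : weightFrom 0 k u = weight k u := by simp [weightFrom, weight]
  set p := weight L.length fun i => dot ω (Packed.row L i) k u
  by_contra hlt
  have hw : w < weight k u := by
    by_contra hw
    have := le_weight_of_enumCheck hω h1 hu (by omega)
    omega
  set E := (List.range s).map Packed.unit ++ L with hE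
  have hlen : E.length = s + L.length := by simp [hE]
  set y : ℕ → F := fun l => dot ω (Packed.row E l) k u with hy
  have hyp : weightFrom s (s + L.length) y = p := by
    rw [weightFrom_add]
    refine weight_congr fun i _ => ?_
    simp only [hy, hE, Packed.row]
    rw [List.getD_append_right _ _ _ _ (by simp)]
    simp
  have hrec : ∀ i < k, dot ω (Packed.row Q i) (s + L.length) y = u i := fun i hi => by
    rw [← hlen]
    exact dot_dot hω h u hi
  have hy0 : ∃ i < s + L.length, y i ≠ 0 := by
    by_contra! hy0
    obtain ⟨i, hi, hui⟩ := hu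
    refine hui ?_
    rw [← hrec i hi]
    exact Finset.sum_eq_zero fun l hl => by rw [hy0 l (Finset.mem_range.1 hl), mul_zero]
  have := le_weight_of_enumCheck hω h2 hy0 (by omega)
  rw [hyp, hQ, weight_congr hrec] at this
  omega

end MinWeight

/-! ### Shortened, punctured and padded codes -/

/-- A code derived from the systematic code `{(u, B u)}`: it keeps the first `k` columns and the
first `r` rows of `B` and adds `p` zero rows, that is, the code is shortened, punctured and padded
with zero coordinates. The packed vector `message` gives a codeword of least weight, and `inverse`
is the list of rows of the inverse of a Gram matrix. -/
structure Member where
  k : ℕ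
  r : ℕ
  p : ℕ
  message : Packed
  inverse : List Packed

/-- The list `N` of rows is a right inverse of `1 + X Y`, where `X` and `Y` are given by their
rows. -/
def isInverse (X Y N : List Packed) : Bool :=
  Nat.beq N.length X.length && (List.range X.length).all fun i =>
    decide ((Packed.add (Packed.unit i) ((Packed.row X i).comb Y)).comb N = Packed.unit i)

/-- The number of nonzero entries among the first `n` entries of a packed vector. -/
def Packed.weight (n : ℕ) (v : Packed) : ℕ :=
  Nat.count (fun i => (v.1.testBit i || v.2.testBit i) = true) n

namespace Member

/-- The rows of the matrix of the derived code. -/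
def rows (m : Member) (L : List Packed) : List Packed := L.take m.r ++ List.replicate m.p (0, 0)

/-- The columns of the matrix of the derived code. -/
def columns (m : Member) (L : List Packed) : List Packed :=
  (List.range m.k).map fun j => Packed.column j (m.rows L)

/-- The parameters of the derived code, if the original code has parity rows `L` and minimum
weight `d` and the puncturing lowers the minimum weight as far as possible. -/
def params (m : Member) (L : List Packed) (d : ℕ) : ℕ × ℕ × ℕ :=
  (m.k + (m.r + m.p), m.k, d - (L.length - m.r))

/-- The certificates of the derived code are correct. -/
def check (m : Member) (L : List Packed) (k d : ℕ) : Bool :=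
  Nat.ble m.k k && Nat.ble m.r L.length && Nat.blt (L.length - m.r) d &&
  Nat.beq (m.message.weight m.k +
    (m.message.comb (m.columns L)).weight (m.r + m.p)) (d - (L.length - m.r)) &&
  -- One of the two products is `1 + Bᴴ B`, the other one `1 + B Bᴴ`, up to transposition.
  (isInverse (m.columns L) ((m.rows L).map Packed.conj) m.inverse ||
    isInverse ((m.rows L).map Packed.conj) (m.columns L) m.inverse)

end Member

section Sound

variable {F : Type*} [Field F] {ω : F}

/-- The matrix with the given list of rows. -/
def toMatrix (ω : F) (L : List Packed) (r k : ℕ) : Matrix (Fin r) (Fin k) F :=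
  Matrix.of fun i j => (Packed.row L i).entry ω j

theorem mul_eq_one_of_isInverse (hω : IsOmega ω) {X Y N : List Packed} {p q : ℕ}
    (hX : X.length = p) (hY : Y.length = q) (h : isInverse X Y N = true) :
    (1 + toMatrix ω X p q * toMatrix ω Y q p) * toMatrix ω N p p = 1 := by
  subst hX hY
  rw [isInverse, Bool.and_eq_true] at h
  obtain ⟨hN, h⟩ := h
  ext i l
  have hi := of_decide_eq_true (List.all_eq_true.1 h i (List.mem_range.2 i.2))
  have hil := congrArg (fun v => Packed.entry ω v l) hi
  simp only [Packed.entry_comb hω, Packed.entry_add hω, Packed.entry_unit,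
    Nat.eq_of_beq_eq_true hN] at hil
  rw [Finset.sum_range] at hil
  simp only [Finset.sum_range (n := Y.length)] at hil
  simpa [Matrix.mul_apply, toMatrix, Matrix.one_apply, Fin.ext_iff] using hil

theorem row_map_conj (L : List Packed) (i : ℕ) :
    Packed.row (L.map Packed.conj) i = (Packed.row L i).conj := by
  simp only [Packed.row, List.getD_eq_getElem?_getD, List.getElem?_map]
  cases L[i]? <;> rfl

theorem toMatrix_map_conj (hω : IsOmega ω) (L : List Packed) (r k : ℕ) :
    toMatrix ω (L.map Packed.conj) r k = (toMatrix ω L r k).map (· ^ 2) := by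
  ext i j
  simp [toMatrix, row_map_conj, Packed.entry_conj hω]

theorem toMatrix_columns (m : Member) (L : List Packed) (r : ℕ) :
    toMatrix ω (m.columns L) m.k r = (toMatrix ω (m.rows L) r m.k).transpose := by
  ext j i
  have : Packed.row (m.columns L) j = Packed.column j (m.rows L) := by
    simp [Packed.row, Member.columns]
  simp [toMatrix, this, Packed.entry_column]

theorem toMatrix_mulVec (L : List Packed) (r k : ℕ) (u : ℕ → F) (i : Fin r) :
    (toMatrix ω L r k).mulVec (fun j => u j) i = dot ω (Packed.row L i) k u := by
  rw [dot, Finset.sum_range]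
  rfl

variable [DecidableEq F]

theorem hammingNorm_eq_weight {n : ℕ} (x : ℕ → F) :
    hammingNorm (fun i : Fin n => x i) = weight n x := by
  rw [weight, Nat.count_eq_card_filter_range, Finset.card_filter, Finset.sum_range, hammingNorm,
    Finset.card_filter]

theorem weight_entry (hω : IsOmega ω) (n : ℕ) (v : Packed) :
    weight n (v.entry ω) = v.weight n := by
  simp only [weight, Packed.weight, Packed.entry, Ne, hω.scalar_eq_zero, Bool.not_eq_false]

theorem row_rows_of_lt {m : Member} {L : List Packed} (hr : m.r ≤ L.length) {i : ℕ}
    (hi : i < m.r) : Packed.row (m.rows L) i = Packed.row L i := by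
  rw [Packed.row, Member.rows, List.getD_append _ _ _ _ (by simp; omega)]
  simp [Packed.row, List.getD_eq_getElem?_getD, hi]

theorem exists_of_check (hω : IsOmega ω) {L : List Packed} {k d : ℕ} (hL : MinWeightGE ω L k d)
    {m : Member} (h : m.check L k d = true) {n k' d' : ℕ} (hp : (n, k', d') = m.params L d) :
    ∃ C : Submodule F (Fin n → F), IsQuaternaryHermitianLCD C k' d' := by
  obtain ⟨rfl, rfl, rfl⟩ : n = _ ∧ k' = _ ∧ d' = _ := by simpa [Member.params] using hp
  simp only [Member.check, Bool.and_eq_true, Bool.or_eq_true, Nat.ble_eq, Nat.blt, Nat.beq_eq]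
    at h
  obtain ⟨⟨⟨⟨hk, hr⟩, hd⟩, hw⟩, hN⟩ := h
  have hlen : (m.rows L).length = m.r + m.p := by simp [Member.rows, hr]
  have hcol : (m.columns L).length = m.k := by simp [Member.columns]
  set B := toMatrix ω (m.rows L) (m.r + m.p) m.k with hB
  have hnorm : ∀ u : ℕ → F, hammingNorm (B.mulVec fun j => u j) =
      weight (m.r + m.p) fun i => dot ω (Packed.row (m.rows L) i) m.k u := fun u => by
    rw [← hammingNorm_eq_weight]
    congr 1
    ext i
    exact toMatrix_mulVec _ _ _ _ _
  refine ⟨_, isQuaternaryHermitianLCD_range_encode B finSumFinEquiv.symm ?_ ?_ ?_⟩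
  · intro u hu
    -- Extended by zeros, the message is one of the original code.
    obtain ⟨j, hj⟩ := Function.ne_iff.1 hu
    set x : ℕ → F := fun i => if h : i < m.k then u ⟨i, h⟩ else 0 with hx
    have hux : u = fun j : Fin m.k => x j := by ext j; simp [hx]
    have h0 : ∀ i, m.k ≤ i → x i = 0 := fun i hi => by simp [hx, not_lt.2 hi]
    have hdot : ∀ v, dot ω v k x = dot ω v m.k x := fun v => by
      refine (Finset.sum_subset (Finset.range_mono hk) fun i _ hi => ?_).symm
      rw [h0 i (by simpa using hi), mul_zero]
    have hwx : weight k x = weight m.k x := by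
      obtain ⟨c, rfl⟩ := Nat.exists_eq_add_of_le hk
      rw [weight_add]
      simp [h0, weight]
    have key := hL x ⟨j, j.2.trans_le hk, by simpa [hux] using hj⟩
    simp only [hdot, hwx] at key
    rw [hux, hnorm, hammingNorm_eq_weight, weight_add]
    obtain ⟨c, hc⟩ := Nat.exists_eq_add_of_le hr
    have hle : weight c (fun i => dot ω (Packed.row L (m.r + i)) m.k x) ≤ c := Nat.count_le _
    have hrows : (weight m.r fun i => dot ω (Packed.row (m.rows L) i) m.k x) =
        weight m.r fun i => dot ω (Packed.row L i) m.k x :=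
      weight_congr fun i hi => by rw [row_rows_of_lt hr hi]
    rw [hc, weight_add] at key
    rw [hrows]
    omega
  · refine ⟨fun j => m.message.entry ω j, fun h => ?_, ?_⟩
    all_goals
      have hsum : hammingNorm (fun j : Fin m.k => m.message.entry ω j) +
          hammingNorm (B.mulVec fun j => m.message.entry ω j) = d - (L.length - m.r) := by
        rw [hnorm, hammingNorm_eq_weight, weight_entry hω, ← hw, ← weight_entry hω (m.r + m.p)]
        congr 1
        refine weight_congr fun i _ => ?_
        rw [Packed.entry_comb hω, hcol]
        refine Finset.sum_congr rfl fun j hj => ?_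
        have : Packed.row (m.columns L) j = Packed.column j (m.rows L) := by
          simp [Packed.row, Member.columns, Finset.mem_range.1 hj]
        rw [this, Packed.entry_column, mul_comm]
    · rw [h, Matrix.mulVec_zero, hammingNorm_zero] at hsum
      rw [hammingNorm_zero] at hsum
      omega
    · exact hsum
  · rw [hB, ← toMatrix_map_conj hω, ← toMatrix_columns]
    rcases hN with hN | hN
    · exact Or.inl ⟨_, mul_eq_one_of_isInverse hω hcol (by simpa using hlen) hN⟩
    · exact Or.inr ⟨_, mul_eq_one_of_isInverse hω (by simpa using hlen) hcol hN⟩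

end Sound

/-! ### The codes -/

/-- The rows of the parity part `B` of a systematic [17, 13, 3] code `{(u, B u)}`. -/
def parity_17_13_3 : List Packed :=
  [(0x17b7, 0x678), (0x1ef9, 0x1581), (0x1d3d, 0x1318), (0xb86, 0x1581)]

/-- The codes derived from the [17, 13, 3] code. -/
def members_17_13_3 : List Member :=
  [⟨10, 4, 0, (0x2, 0x0),
    [(0xb, 0xa), (0x0, 0xd), (0xa, 0xa), (0x2, 0x7)]⟩,
   ⟨11, 4, 0, (0x3, 0x102),
    [(0xa, 0xe), (0x0, 0xd), (0xf, 0xb), (0x2, 0x7)]⟩,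
   ⟨12, 4, 0, (0x904, 0x104),
    [(0xb, 0x2), (0x0, 0xd), (0x2, 0xa), (0xf, 0x6)]⟩,
   ⟨13, 4, 0, (0x1000, 0x200),
    [(0xa, 0xa), (0x0, 0xd), (0x2, 0xa), (0x6, 0x7)]⟩]

/-- The rows of the parity part `B` of a systematic [29, 23, 4] code `{(u, B u)}`. -/
def parity_29_23_4 : List Packed :=
  [(0x2292ff, 0x333a0c), (0x2d6b2d, 0x7f1826), (0x2105be, 0x4e39ce), (0x284de3, 0x57a7d3),
   (0x452919, 0x40ea1e), (0x85433, 0x7fc282)]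

/-- The codes derived from the [29, 23, 4] code. -/
def members_29_23_4 : List Member :=
  [⟨20, 6, 0, (0xa0, 0x40100),
    [(0x29, 0x38), (0x34, 0x24), (0x3c, 0x22), (0x34, 0x1), (0x2f, 0x1), (0x18, 0x7)]⟩,
   ⟨21, 6, 0, (0x100002, 0x100012),
    [(0x18, 0x22), (0x1f, 0x15), (0x3c, 0x22), (0x1f, 0x30), (0x35, 0x2a), (0x29, 0x1d)]⟩,
   ⟨22, 6, 0, (0x8, 0x28000),
    [(0x37, 0x2c), (0x11, 0x34), (0x32, 0x3), (0x11, 0x11), (0x35, 0x2a), (0x6, 0x13)]⟩,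
   ⟨23, 6, 0, (0x0, 0x420000),
    [(0x37, 0x2c), (0x3b, 0x0), (0x2c, 0x29), (0x3b, 0x25), (0x2b, 0x0), (0x32, 0xd)]⟩]

/-- The rows of the parity part `B` of a systematic [30, 23, 5] code `{(u, B u)}`. -/
def parity_30_23_5 : List Packed :=
  [(0x772cf8, 0x3ea63a), (0x52ef24, 0x51fe82), (0x2d2c68, 0x254255), (0x5c5401, 0x238fe7),
   (0x8edeb, 0x73ce30), (0x229f6, 0x6c1ca4), (0x56bcbf, 0x48e1a4)]

/-- The codes derived from the [30, 23, 5] code. -/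
def members_30_23_5 : List Member :=
  [⟨19, 7, 0, (0x60000, 0x40400),
    [(0x1, 0x6a), (0x65, 0x61), (0x22, 0x40), (0x69, 0x61), (0x30, 0x0), (0x35, 0xb), (0x45, 0xf)]⟩,
   ⟨20, 7, 0, (0x2a0, 0x0),
    [(0x14, 0x54), (0x4e, 0x74), (0x1c, 0x6b), (0x42, 0x74), (0xe, 0x2b), (0x1e, 0x1e), (0x45, 0xf)]⟩,
   ⟨21, 7, 0, (0x51, 0x1),
    [(0x14, 0x54), (0x18, 0x70), (0x18, 0x39), (0x42, 0x74), (0x58, 0x2f), (0x1e, 0x1e),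
     (0x13, 0xb)]⟩,
   ⟨22, 7, 0, (0x100810, 0x10),
    [(0x7d, 0x70), (0x18, 0x70), (0x55, 0x50), (0x2b, 0x50), (0x58, 0x2f), (0x3a, 0x53),
     (0x7a, 0x2f)]⟩,
   ⟨23, 7, 0, (0x400000, 0x100),
    [(0x6a, 0x2c), (0xf, 0x2c), (0x9, 0x1b), (0x60, 0x47), (0x4, 0x64), (0x3a, 0x53), (0x31, 0x38)]⟩,
   ⟨19, 7, 1, (0x2400c, 0x24008),
    [(0x1, 0x6a), (0x65, 0x61), (0x22, 0x40), (0x69, 0x61), (0x30, 0x0), (0x35, 0xb), (0x45, 0xf),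
     (0x80, 0x0)]⟩,
   ⟨20, 7, 1, (0x42000, 0x400),
    [(0x14, 0x54), (0x4e, 0x74), (0x1c, 0x6b), (0x42, 0x74), (0xe, 0x2b), (0x1e, 0x1e), (0x45, 0xf),
     (0x80, 0x0)]⟩,
   ⟨21, 7, 1, (0x121002, 0x100002),
    [(0x14, 0x54), (0x18, 0x70), (0x18, 0x39), (0x42, 0x74), (0x58, 0x2f), (0x1e, 0x1e),
     (0x13, 0xb), (0x80, 0x0)]⟩,
   ⟨22, 7, 1, (0x220, 0x280),
    [(0x7d, 0x70), (0x18, 0x70), (0x55, 0x50), (0x2b, 0x50), (0x58, 0x2f), (0x3a, 0x53),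
     (0x7a, 0x2f), (0x80, 0x0)]⟩]

/-- The rows of the parity part `B` of a systematic [30, 21, 6] code `{(u, B u)}`. -/
def parity_30_21_6 : List Packed :=
  [(0x1b5efa, 0x67f17), (0x8a973, 0xfaf62), (0x163013, 0x7d5b5), (0x362ca, 0x8ed2e),
   (0xee034, 0x147707), (0xe07dc, 0xe7fd), (0x18b554, 0x186ca6), (0xb8a6b, 0xd7f6b),
   (0x139b0f, 0x1eee9)]

/-- The codes derived from the [30, 21, 6] code. -/
def members_30_21_6 : List Member :=
  [⟨17, 9, 0, (0x501, 0x151),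
    [(0x5d, 0x1e2), (0xd5, 0x15d), (0x145, 0x32), (0x43, 0x1b2), (0xcd, 0x1ae), (0xdd, 0x19d),
     (0x17c, 0x83), (0x14b, 0x179), (0x7f, 0xbb)]⟩,
   ⟨18, 9, 0, (0x201, 0x10008),
    [(0x7c, 0x110), (0x6, 0x17c), (0x145, 0x32), (0x43, 0x1b2), (0x1e, 0x18f), (0x2f, 0x14e),
     (0x1af, 0xa2), (0x198, 0x158), (0x7f, 0xbb)]⟩,
   ⟨19, 9, 0, (0x40800, 0x42800),
    [(0xbf, 0x2e), (0x138, 0x81), (0xb8, 0xf1), (0x1be, 0x171), (0x1e3, 0x14c), (0x1d2, 0x18d),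
     (0x16c, 0x19c), (0x15b, 0x66), (0x182, 0x78)]⟩,
   ⟨20, 9, 0, (0x40800, 0x10240),
    [(0x190, 0x8a), (0x17, 0x25), (0x1c, 0x17a), (0x91, 0x1d5), (0x1e3, 0x14c), (0x176, 0x6),
     (0x16c, 0x19c), (0xd0, 0x149), (0xad, 0xdc)]⟩,
   ⟨21, 9, 0, (0x8204, 0x108004),
    [(0x17f, 0xf8), (0x65, 0xb8), (0xf3, 0x108), (0x7e, 0x1a7), (0x17e, 0x1a3), (0x104, 0x9b),
     (0x11e, 0x101), (0x3f, 0x13b), (0xad, 0xdc)]⟩,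
   ⟨16, 9, 1, (0x6000, 0x0),
    [(0x1c6, 0x1fe), (0x14e, 0x141), (0xc2, 0x1a9), (0x5f, 0x35), (0xd1, 0x29), (0xdd, 0x19d),
     (0x17c, 0x83), (0xd0, 0x165), (0x1e4, 0xa7), (0x200, 0x0)]⟩,
   ⟨17, 9, 1, (0xc008, 0x8300),
    [(0x5d, 0x1e2), (0xd5, 0x15d), (0x145, 0x32), (0x43, 0x1b2), (0xcd, 0x1ae), (0xdd, 0x19d),
     (0x17c, 0x83), (0x14b, 0x179), (0x7f, 0xbb), (0x200, 0x0)]⟩,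
   ⟨18, 9, 1, (0x500, 0x0),
    [(0x7c, 0x110), (0x6, 0x17c), (0x145, 0x32), (0x43, 0x1b2), (0x1e, 0x18f), (0x2f, 0x14e),
     (0x1af, 0xa2), (0x198, 0x158), (0x7f, 0xbb), (0x200, 0x0)]⟩,
   ⟨19, 9, 1, (0x8080, 0x200),
    [(0xbf, 0x2e), (0x138, 0x81), (0xb8, 0xf1), (0x1be, 0x171), (0x1e3, 0x14c), (0x1d2, 0x18d),
     (0x16c, 0x19c), (0x15b, 0x66), (0x182, 0x78), (0x200, 0x0)]⟩,
   ⟨20, 9, 1, (0x40800, 0x40),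
    [(0x190, 0x8a), (0x17, 0x25), (0x1c, 0x17a), (0x91, 0x1d5), (0x1e3, 0x14c), (0x176, 0x6),
     (0x16c, 0x19c), (0xd0, 0x149), (0xad, 0xdc), (0x200, 0x0)]⟩]

/-- The rows of the parity part `B` of a systematic [30, 19, 7] code `{(u, B u)}`. -/
def parity_30_19_7 : List Packed :=
  [(0x28fff, 0x4e517), (0x462ce, 0x5046c), (0x15a64, 0x50f3), (0x5c4c9, 0x62043),
   (0x14e3a, 0x137d1), (0x9e20, 0x1ecd9), (0x127d4, 0x6d042), (0x5a93b, 0x1ad19),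
   (0x7adf3, 0x46457), (0x1fbfa, 0x37fc6), (0x136f4, 0x22f7c)]

/-- The message symbols of this code in terms of its first 8 message symbols and its parity
symbols. -/
def recovery_30_19_7 : List Packed :=
  [(0x1, 0x0), (0x2, 0x0), (0x4, 0x0), (0x8, 0x0), (0x10, 0x0), (0x20, 0x0), (0x40, 0x0),
   (0x80, 0x0), (0x3f1, 0x2b19f), (0x2566a, 0x3b900), (0x56915, 0x1ce4b), (0x65505, 0x6c6f8),
   (0x67d59, 0x77261), (0x7681, 0x730d7), (0xa65, 0x7fe26), (0x6b1fa, 0x5488c), (0x2fc70, 0x30837),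
   (0x7ea9f, 0x6f8d8), (0x62484, 0x6cab8)]

/-- The codes derived from the [30, 19, 7] code. -/
def members_30_19_7 : List Member :=
  [⟨15, 11, 0, (0x4408, 0x1),
    [(0x19d, 0x4a6), (0x5d, 0x2cd), (0x344, 0x6b3), (0x99, 0x602), (0x5df, 0x64), (0x1d5, 0x695),
     (0x1e4, 0x12), (0x25e, 0x327), (0x7f5, 0x480), (0x12a, 0xae), (0x3d, 0x12d)]⟩,
   ⟨16, 11, 0, (0x1022, 0x142),
    [(0x19d, 0x4a6), (0x50b, 0x301), (0x288, 0x229), (0x403, 0x354), (0x89, 0x1a8), (0x1d5, 0x695),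
     (0x28, 0x488), (0x6c4, 0x671), (0x639, 0x1a), (0x12a, 0xae), (0x56b, 0xe1)]⟩,
   ⟨17, 11, 0, (0x2001, 0x4),
    [(0x2be, 0x7f0), (0x65d, 0x374), (0x2fd, 0x10a), (0x403, 0x354), (0xfc, 0x28b), (0x2f6, 0x5c3),
     (0x5d, 0x7ab), (0x6c4, 0x671), (0x56f, 0x6f), (0x27c, 0xdb), (0x56b, 0xe1)]⟩,
   ⟨18, 11, 0, (0x20482, 0x0),
    [(0x1b9, 0x4e4), (0x55a, 0x60), (0x1e9, 0x119), (0x403, 0x354), (0xef, 0x18c), (0x2f6, 0x5c3),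
     (0x5d, 0x7ab), (0x6c4, 0x671), (0x67b, 0x7c), (0x168, 0xc8), (0x56b, 0xe1)]⟩,
   ⟨19, 11, 0, (0x21000, 0x20044),
    [(0x58, 0x71c), (0x55a, 0x60), (0x1e9, 0x119), (0x61a, 0x2b5), (0x2f6, 0x6d), (0x10e, 0x7da),
     (0x3a5, 0x5b2), (0x53c, 0x468), (0x583, 0x265), (0x371, 0x129), (0x56b, 0xe1)]⟩,
   ⟨14, 11, 1, (0x0, 0x11),
    [(0x7a0, 0x552), (0x5d, 0x2cd), (0x2b0, 0x17a), (0x6a4, 0x7f6), (0x42b, 0x7ad), (0x21, 0x15c),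
     (0x62d, 0x62f), (0x597, 0x51a), (0x3c, 0x2bd), (0x717, 0x15a), (0x600, 0xd9), (0x800, 0x0)]⟩,
   ⟨15, 11, 1, (0x566, 0x104),
    [(0x19d, 0x4a6), (0x5d, 0x2cd), (0x344, 0x6b3), (0x99, 0x602), (0x5df, 0x64), (0x1d5, 0x695),
     (0x1e4, 0x12), (0x25e, 0x327), (0x7f5, 0x480), (0x12a, 0xae), (0x3d, 0x12d), (0x800, 0x0)]⟩,
   ⟨16, 11, 1, (0x280, 0x1240),
    [(0x19d, 0x4a6), (0x50b, 0x301), (0x288, 0x229), (0x403, 0x354), (0x89, 0x1a8), (0x1d5, 0x695),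
     (0x28, 0x488), (0x6c4, 0x671), (0x639, 0x1a), (0x12a, 0xae), (0x56b, 0xe1), (0x800, 0x0)]⟩,
   ⟨17, 11, 1, (0x2008, 0xa000),
    [(0x2be, 0x7f0), (0x65d, 0x374), (0x2fd, 0x10a), (0x403, 0x354), (0xfc, 0x28b), (0x2f6, 0x5c3),
     (0x5d, 0x7ab), (0x6c4, 0x671), (0x56f, 0x6f), (0x27c, 0xdb), (0x56b, 0xe1), (0x800, 0x0)]⟩,
   ⟨18, 11, 1, (0x20408, 0x20008),
    [(0x1b9, 0x4e4), (0x55a, 0x60), (0x1e9, 0x119), (0x403, 0x354), (0xef, 0x18c), (0x2f6, 0x5c3),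
     (0x5d, 0x7ab), (0x6c4, 0x671), (0x67b, 0x7c), (0x168, 0xc8), (0x56b, 0xe1), (0x800, 0x0)]⟩]

/-- The rows of the parity part `B` of a systematic [30, 17, 8] code `{(u, B u)}`. -/
def parity_30_17_8 : List Packed :=
  [(0x16f06, 0xd9e3), (0x33d5, 0x16a6f), (0x1c888, 0x1a1aa), (0xbb5b, 0x523), (0xe6b6, 0xd7d7),
   (0x13631, 0xeaae), (0x2a87, 0x170d2), (0x188c9, 0x43bf), (0x1f323, 0xbf3a), (0x17c0c, 0x107bc),
   (0x1abe2, 0xfbfa), (0x2080, 0x0), (0x687e, 0x1544)]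

/-- The message symbols of this code in terms of its first 4 message symbols and its parity
symbols. -/
def recovery_30_17_8 : List Packed :=
  [(0x1, 0x0), (0x2, 0x0), (0x4, 0x0), (0x8, 0x0), (0x12210, 0xc0ba), (0x182a3, 0x4acd),
   (0xcc66, 0xf98c), (0x1ddd7, 0xb62d), (0x139c7, 0x129d1), (0x1b218, 0x3cf0), (0x12e7c, 0x13f3c),
   (0x1c0b2, 0x1e2e), (0x1f8e, 0x1122b), (0x15dd7, 0xb62d), (0xcf4, 0x1e2e5), (0x1bbe9, 0x15f04),
   (0x1a97d, 0x3f55)]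

/-- The codes derived from the [30, 17, 8] code. -/
def members_30_17_8 : List Member :=
  [⟨14, 13, 0, (0x800, 0x1900),
    [(0x184c, 0xf72), (0x1641, 0x1bb9), (0x209, 0x560), (0x19bf, 0xa32), (0x8b3, 0x198b),
     (0x19b7, 0x1ecf), (0x6a6, 0x425), (0x4ca, 0x1332), (0x15bf, 0x1897), (0x4ed, 0x18ab),
     (0x1fa7, 0x65), (0xf02, 0x33b), (0x1699, 0x3b2)]⟩,
   ⟨15, 13, 0, (0x5110, 0x101),
    [(0x184c, 0xf72), (0x1641, 0x1bb9), (0x209, 0x560), (0x1e57, 0x1bf2), (0x8b3, 0x198b),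
     (0x1e5f, 0xf0f), (0x1766, 0x120d), (0x150a, 0x51a), (0x47f, 0xebf), (0x305, 0x96b),
     (0x184f, 0x11a5), (0xf02, 0x33b), (0xb1, 0x45a)]⟩,
   ⟨16, 13, 0, (0x14, 0x210),
    [(0x617, 0x17e), (0x81a, 0x15b5), (0x125e, 0x1b3b), (0x105b, 0xba5), (0x16e8, 0x1787),
     (0x1e5f, 0xf0f), (0x93d, 0x1c01), (0x150a, 0x51a), (0x47f, 0xebf), (0xd09, 0x193c),
     (0x1643, 0x1f2), (0x10e, 0x136c), (0x1eea, 0xa56)]⟩,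
   ⟨17, 13, 0, (0x1001, 0x10),
    [(0x617, 0x17e), (0x1bf8, 0xdcd), (0x125e, 0x1b3b), (0x1bc1, 0x1847), (0x1d72, 0x465),
     (0x627, 0x495), (0x1145, 0x179b), (0x6e8, 0x1d62), (0x179d, 0x16c7), (0x1eeb, 0x144),
     (0x1643, 0x1f2), (0xa94, 0x8e), (0x692, 0x1cc)]⟩]

/-- The rows of the parity part `B` of a systematic [30, 16, 9] code `{(u, B u)}`. -/
def parity_30_16_9 : List Packed :=
  [(0xcbbd, 0x1554), (0x3a08, 0x3dba), (0x5760, 0x7c94), (0x9e42, 0x7c7c), (0x306e, 0x7736),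
   (0xea66, 0x9d8c), (0x3fea, 0x9ef7), (0xad66, 0x893b), (0xb082, 0x34d9), (0xa5bf, 0x6bd0),
   (0x88a1, 0x9ead), (0x4f5a, 0xe418), (0xd17f, 0x5d9d), (0x1666, 0x20b)]

/-- The message symbols of this code in terms of its first 2 message symbols and its parity
symbols. -/
def recovery_30_16_9 : List Packed :=
  [(0x1, 0x0), (0x2, 0x0), (0xcc10, 0xb8d1), (0x6af7, 0x7b06), (0xa00b, 0xc2bc), (0x5265, 0x7d72),
   (0x55ae, 0x71c3), (0x841a, 0x8b9), (0x6b5f, 0x53f3), (0xf83c, 0x5693), (0x5bd2, 0x6eb6),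
   (0x203f, 0x93a6), (0xc5a2, 0x3318), (0x1530, 0x33e4), (0x9839, 0x1dc9), (0xfe00, 0x36c6)]

/-- The codes derived from the [30, 16, 9] code. -/
def members_30_16_9 : List Member :=
  [⟨12, 14, 0, (0x400, 0x808),
    [(0xde, 0x46), (0x7e, 0x245), (0x86c, 0x9fb), (0xf3b, 0x964), (0x9df, 0xee4), (0x852, 0x69c),
     (0x368, 0xf9f), (0xc65, 0x674), (0xb14, 0x4c), (0xbba, 0x8f2), (0xc78, 0x8f0), (0x9e0, 0x65c)]⟩,
   ⟨13, 14, 0, (0x80c, 0x1280),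
    [(0x1fd7, 0xb1c), (0x142d, 0x1d4c), (0x86c, 0x9fb), (0x461, 0x1d37), (0x1d8c, 0x11ed),
     (0x852, 0x69c), (0x173b, 0x1096), (0xc65, 0x674), (0x4e, 0x141f), (0xe0, 0x1ca1),
     (0x1371, 0x3aa), (0x2ba, 0x120f), (0x1f09, 0xb5a)]⟩,
   ⟨14, 14, 0, (0xe, 0x3d),
    [(0x3a57, 0x6a4), (0x243d, 0x19bc), (0x2d1c, 0x16b3), (0x17ac, 0x3e12), (0x2d59, 0x238e),
     (0x16cd, 0x2f07), (0x3431, 0x2e80), (0x77f, 0xc57), (0x2ae, 0x3432), (0x2dd4, 0x107d),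
     (0x313, 0x1ed), (0x2ff, 0x20ea), (0x2367, 0x230e), (0x2b2f, 0x1978)]⟩,
   ⟨15, 14, 0, (0x2229, 0x21),
    [(0x3d18, 0x3e0c), (0x2372, 0x2114), (0x2a53, 0x2e1b), (0x2f04, 0x1f5), (0x2d59, 0x238e),
     (0x292a, 0x2848), (0x337e, 0x1628), (0x3898, 0xb18), (0x5e1, 0xc9a), (0x2a9b, 0x28d5),
     (0x45c, 0x3945), (0x3d18, 0x27a5), (0x1c80, 0x2441), (0x14c8, 0x1e37)]⟩,
   ⟨16, 14, 0, (0x431a, 0x218),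
    [(0x3d18, 0x3e0c), (0x2910, 0x3e84), (0x2a53, 0x2e1b), (0x2f04, 0x1f5), (0x38ab, 0x29ec),
     (0x2348, 0x37d8), (0x391c, 0x9b8), (0x2d6a, 0x17a), (0x1013, 0x6f8), (0x350b, 0x3d27),
     (0x11ae, 0x3327), (0x2288, 0x3257), (0x972, 0x2e23), (0x14c8, 0x1e37)]⟩]

/-- The rows of the parity part `B` of a systematic [30, 10, 14] code `{(u, B u)}`. -/
def parity_30_10_14 : List Packed :=
  [(0x131, 0x1d0), (0x26d, 0x206), (0x34b, 0x305), (0xd8, 0x3d2), (0x14a, 0xa9), (0x3b9, 0x364),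
   (0x66, 0x1e7), (0x288, 0x31d), (0x32d, 0x132), (0x3f1, 0x337), (0x3a1, 0x53), (0x3f3, 0x2be),
   (0x10c, 0x3c1), (0x1c1, 0x338), (0x152, 0x3c7), (0x377, 0x240), (0x25f, 0x1ea), (0x30a, 0x156),
   (0x3f6, 0x62), (0x226, 0x22e)]

/-- The codes derived from the [30, 10, 14] code. -/
def members_30_10_14 : List Member :=
  [⟨10, 20, 0, (0x7, 0xd),
    [(0x144, 0x2a6), (0x27, 0x1d), (0x170, 0xeb), (0x286, 0x136), (0x3ae, 0x1ea), (0x26b, 0x39d),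
     (0x131, 0x314), (0x22d, 0x235), (0x12d, 0x78), (0x259, 0xe1)]⟩,
   ⟨10, 19, 0, (0x8, 0x0),
    [(0x117, 0x29c), (0x1d, 0x74), (0x170, 0xeb), (0x2ef, 0x165), (0x394, 0x183), (0x202, 0x3ce),
     (0x162, 0x32e), (0x22d, 0x235), (0x12d, 0x78), (0x259, 0xe1)]⟩,
   ⟨10, 18, 0, (0x40, 0x9),
    [(0x13a, 0x198), (0x1d, 0x74), (0x274, 0x3c2), (0x2c2, 0x261), (0x394, 0x183), (0x22f, 0xca),
     (0x162, 0x32e), (0x22d, 0x235), (0x204, 0x55), (0x170, 0xcc)]⟩,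
   ⟨10, 17, 0, (0x301, 0x50),
    [(0x353, 0x3e6), (0xa, 0x21d), (0x263, 0x1ab), (0xbc, 0x276), (0x383, 0x3ea), (0x51, 0xdd),
     (0x31c, 0x339), (0x22d, 0x235), (0x204, 0x55), (0x30e, 0xdb)]⟩,
   ⟨9, 20, 0, (0x42, 0x0),
    [(0x1a5, 0x1e), (0x27, 0x1d), (0x170, 0xeb), (0xdf, 0x1d7), (0x1f7, 0x10b), (0xd3, 0x1c4),
     (0x1d0, 0x1ac), (0x95, 0x6c), (0x12d, 0x78)]⟩,
   ⟨9, 20, 1, (0x89, 0x48),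
    [(0x1a5, 0x1e), (0x27, 0x1d), (0x170, 0xeb), (0xdf, 0x1d7), (0x1f7, 0x10b), (0xd3, 0x1c4),
     (0x1d0, 0x1ac), (0x95, 0x6c), (0x12d, 0x78)]⟩,
   ⟨8, 20, 0, (0x8, 0xac),
    [(0x88, 0x66), (0x27, 0x1d), (0x5d, 0x93), (0xa7, 0x82), (0xa2, 0x26), (0xab, 0x91),
     (0x85, 0x81), (0x95, 0x6c)]⟩,
   ⟨8, 20, 1, (0x50, 0x4),
    [(0x88, 0x66), (0x27, 0x1d), (0x5d, 0x93), (0xa7, 0x82), (0xa2, 0x26), (0xab, 0x91),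
     (0x85, 0x81), (0x95, 0x6c)]⟩,
   ⟨7, 20, 0, (0x42, 0x0),
    [(0x1d, 0xa), (0x27, 0x1d), (0x31, 0x6a), (0x5e, 0x17), (0x37, 0x4a), (0x52, 0x4), (0x7c, 0x14)]⟩,
   ⟨7, 20, 1, (0xd, 0x20),
    [(0x1d, 0xa), (0x27, 0x1d), (0x31, 0x6a), (0x5e, 0x17), (0x37, 0x4a), (0x52, 0x4), (0x7c, 0x14)]⟩,
   ⟨6, 20, 0, (0x29, 0x30),
    [(0x1d, 0xa), (0x27, 0x1d), (0x25, 0x2), (0x22, 0x3), (0x23, 0x22), (0x2e, 0x10)]⟩,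
   ⟨7, 19, 0, (0x50, 0x1a),
    [(0x4e, 0x30), (0x1d, 0x74), (0x31, 0x6a), (0x37, 0x44), (0xd, 0x23), (0x3b, 0x57),
     (0x2f, 0x2e)]⟩,
   ⟨8, 18, 0, (0x58, 0x90),
    [(0x86, 0xe8), (0x1d, 0x74), (0xe9, 0x7a), (0x93, 0x65), (0x2c, 0xa6), (0x2b, 0x9f),
     (0x8b, 0xf), (0x7c, 0x31)]⟩]

/-- The rows of the parity part `B` of a systematic [30, 8, 15] code `{(u, B u)}`. -/
def parity_30_8_15 : List Packed :=
  [(0x2e, 0x3e), (0xa1, 0x3b), (0x20, 0x46), (0xb7, 0xc6), (0xc3, 0x4), (0xd9, 0x16), (0xd9, 0x15),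
   (0x99, 0x7d), (0x9e, 0x11), (0xa1, 0xc), (0xe1, 0xed), (0x39, 0x25), (0xe9, 0x72), (0x4c, 0x96),
   (0x32, 0x37), (0xa2, 0xc4), (0x16, 0x25), (0x76, 0x13), (0xaf, 0x8f), (0x54, 0x9), (0x78, 0x49),
   (0x8c, 0xc4)]

/-- The codes derived from the [30, 8, 15] code. -/
def members_30_8_15 : List Member :=
  [⟨8, 22, 0, (0x6a, 0x8a),
    [(0x12, 0x64), (0xd1, 0xcc), (0x17, 0x8b), (0xee, 0x96), (0x2f, 0x68), (0x49, 0x51),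
     (0xd9, 0xb3), (0x84, 0x4e)]⟩,
   ⟨7, 22, 0, (0x4a, 0x40),
    [(0x12, 0x64), (0x1b, 0x48), (0x59, 0x41), (0x24, 0x12), (0x2f, 0x68), (0x49, 0x51),
     (0x13, 0x37)]⟩]

/-- The rows of the parity part `B` of a systematic [30, 6, 18] code `{(u, B u)}`. -/
def parity_30_6_18 : List Packed :=
  [(0xf, 0x20), (0x24, 0x27), (0x3d, 0x3d), (0xb, 0x16), (0x2e, 0x8), (0x2e, 0x5), (0x1f, 0x36),
   (0x1c, 0x1e), (0xa, 0x5), (0x3b, 0x14), (0x3f, 0x33), (0xd, 0xd), (0x1a, 0xf), (0x11, 0x10),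
   (0x13, 0x14), (0x2c, 0x33), (0x35, 0x23), (0x4, 0x28), (0x16, 0x30), (0x24, 0x38), (0x22, 0x34),
   (0x1a, 0x31), (0x31, 0x25), (0x18, 0x35)]

/-- The codes derived from the [30, 6, 18] code. -/
def members_30_6_18 : List Member :=
  [⟨6, 23, 0, (0x37, 0x2c),
    [(0xd, 0x24), (0x28, 0x18), (0xc, 0x9), (0x9, 0x16), (0xa, 0x2a), (0x33, 0x11)]⟩,
   ⟨6, 23, 1, (0x0, 0x34),
    [(0xd, 0x24), (0x28, 0x18), (0xc, 0x9), (0x9, 0x16), (0xa, 0x2a), (0x33, 0x11)]⟩]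

/-- The rows of the parity part `B` of a systematic [30, 5, 19] code `{(u, B u)}`. -/
def parity_30_5_19 : List Packed :=
  [(0x12, 0x16), (0x6, 0x7), (0xa, 0x16), (0x13, 0xa), (0x16, 0x13), (0x17, 0x6), (0x16, 0x3),
   (0x5, 0xb), (0x0, 0x1e), (0x1, 0x8), (0x1f, 0xa), (0x1a, 0x18), (0x16, 0x19), (0x3, 0x19),
   (0x6, 0x1b), (0x13, 0x13), (0x9, 0xa), (0x5, 0x1d), (0xc, 0x2), (0xb, 0x14), (0x14, 0xe),
   (0x1f, 0x10), (0x1d, 0x3), (0x7, 0x2), (0x1, 0xe)]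

/-- The codes derived from the [30, 5, 19] code. -/
def members_30_5_19 : List Member :=
  [⟨5, 25, 0, (0x6, 0x12),
    [(0x18, 0xc), (0x1c, 0xc), (0x1, 0x3), (0x18, 0x13), (0x13, 0x8)]⟩,
   ⟨5, 24, 0, (0xe, 0x8),
    [(0x11, 0x4), (0x1c, 0xc), (0x1, 0x3), (0x10, 0x12), (0x13, 0x8)]⟩,
   ⟨5, 23, 0, (0xd, 0xc),
    [(0x1a, 0x18), (0x17, 0x10), (0x16, 0x8), (0xc, 0x5), (0x4, 0x3)]⟩,
   ⟨4, 25, 1, (0xb, 0xf),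
    [(0xb, 0x4), (0xf, 0x4), (0x1, 0x3), (0x3, 0x0)]⟩,
   ⟨4, 24, 1, (0xc, 0x5),
    [(0x2, 0xc), (0xf, 0x4), (0x1, 0x3), (0xb, 0x1)]⟩]

/-- The rows of the parity part `B` of a systematic [26, 4, 17] code `{(u, B u)}`. -/
def parity_26_4_17 : List Packed :=
  [(0xb, 0x4), (0xe, 0x4), (0x5, 0x9), (0x2, 0x7), (0x4, 0xd), (0xe, 0x7), (0x8, 0x1), (0xa, 0x9),
   (0x9, 0x4), (0xe, 0xf), (0xd, 0xf), (0x6, 0x5), (0x9, 0x5), (0x9, 0xd), (0xb, 0x2), (0x7, 0x8),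
   (0x2, 0x4), (0xf, 0xc), (0x1, 0x2), (0x9, 0x7), (0x6, 0x1), (0x2, 0xe)]

/-- The codes derived from the [26, 4, 17] code. -/
def members_26_4_17 : List Member :=
  [⟨4, 22, 0, (0xa, 0xe),
    [(0x0, 0xe), (0xf, 0xd), (0x9, 0x3), (0xd, 0x3)]⟩,
   ⟨4, 22, 1, (0xa, 0xe),
    [(0x0, 0xe), (0xf, 0xd), (0x9, 0x3), (0xd, 0x3)]⟩]

/-! ### Certification of the codes -/

section Certification

variable {F : Type*} [Field F] [DecidableEq F] {ω : F}

theorem minWeightGE_17_13_3 (hω : IsOmega ω) : MinWeightGE ω parity_17_13_3 13 3 :=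
  minWeightGE_of_enumCheck hω (by decide +kernel)

theorem minWeightGE_29_23_4 (hω : IsOmega ω) : MinWeightGE ω parity_29_23_4 23 4 :=
  minWeightGE_of_enumCheck hω (by decide +kernel)

theorem minWeightGE_30_23_5 (hω : IsOmega ω) : MinWeightGE ω parity_30_23_5 23 5 :=
  minWeightGE_of_enumCheck hω (by decide +kernel)

theorem minWeightGE_30_21_6 (hω : IsOmega ω) : MinWeightGE ω parity_30_21_6 21 6 :=
  minWeightGE_of_enumCheck hω (by decide +kernel)

theorem minWeightGE_30_19_7 (hω : IsOmega ω) : MinWeightGE ω parity_30_19_7 19 7 :=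
  minWeightGE_of_enumCheck_of_enumCheck (s := 8) (w := 5) (Q := recovery_30_19_7) hω
    (by decide +kernel) (by decide +kernel) (by decide +kernel) (by decide +kernel)

theorem minWeightGE_30_17_8 (hω : IsOmega ω) : MinWeightGE ω parity_30_17_8 17 8 :=
  minWeightGE_of_enumCheck_of_enumCheck (s := 4) (w := 4) (Q := recovery_30_17_8) hω
    (by decide +kernel) (by decide +kernel) (by decide +kernel) (by decide +kernel)

theorem minWeightGE_30_16_9 (hω : IsOmega ω) : MinWeightGE ω parity_30_16_9 16 9 :=
  minWeightGE_of_enumCheck_of_enumCheck (s := 2) (w := 4) (Q := recovery_30_16_9) hω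
    (by decide +kernel) (by decide +kernel) (by decide +kernel) (by decide +kernel)

theorem minWeightGE_30_10_14 (hω : IsOmega ω) : MinWeightGE ω parity_30_10_14 10 14 :=
  minWeightGE_of_enumCheck hω (by decide +kernel)

theorem minWeightGE_30_8_15 (hω : IsOmega ω) : MinWeightGE ω parity_30_8_15 8 15 :=
  minWeightGE_of_enumCheck hω (by decide +kernel)

theorem minWeightGE_30_6_18 (hω : IsOmega ω) : MinWeightGE ω parity_30_6_18 6 18 :=
  minWeightGE_of_enumCheck hω (by decide +kernel)

theorem minWeightGE_30_5_19 (hω : IsOmega ω) : MinWeightGE ω parity_30_5_19 5 19 :=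
  minWeightGE_of_enumCheck hω (by decide +kernel)

theorem minWeightGE_26_4_17 (hω : IsOmega ω) : MinWeightGE ω parity_26_4_17 4 17 :=
  minWeightGE_of_enumCheck hω (by decide +kernel)

theorem check_17_13_3 : (members_17_13_3.all fun m => m.check parity_17_13_3 13 3) = true := by
  decide +kernel

theorem check_29_23_4 : (members_29_23_4.all fun m => m.check parity_29_23_4 23 4) = true := by
  decide +kernel

theorem check_30_23_5 : (members_30_23_5.all fun m => m.check parity_30_23_5 23 5) = true := by
  decide +kernel

theorem check_30_21_6 : (members_30_21_6.all fun m => m.check parity_30_21_6 21 6) = true := by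
  decide +kernel

theorem check_30_19_7 : (members_30_19_7.all fun m => m.check parity_30_19_7 19 7) = true := by
  decide +kernel

theorem check_30_17_8 : (members_30_17_8.all fun m => m.check parity_30_17_8 17 8) = true := by
  decide +kernel

theorem check_30_16_9 : (members_30_16_9.all fun m => m.check parity_30_16_9 16 9) = true := by
  decide +kernel

theorem check_30_10_14 : (members_30_10_14.all fun m => m.check parity_30_10_14 10 14) = true := by
  decide +kernel

theorem check_30_8_15 : (members_30_8_15.all fun m => m.check parity_30_8_15 8 15) = true := by
  decide +kernel

theorem check_30_6_18 : (members_30_6_18.all fun m => m.check parity_30_6_18 6 18) = true := by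
  decide +kernel

theorem check_30_5_19 : (members_30_5_19.all fun m => m.check parity_30_5_19 5 19) = true := by
  decide +kernel

theorem check_26_4_17 : (members_26_4_17.all fun m => m.check parity_26_4_17 4 17) = true := by
  decide +kernel

theorem exists_of_mem_params (hω : IsOmega ω) {L : List Packed} {k d : ℕ}
    (hL : MinWeightGE ω L k d) {M : List Member} (hM : (M.all fun m => m.check L k d) = true)
    {n k' d' : ℕ} (h : (n, k', d') ∈ M.map fun m => m.params L d) :
    ∃ C : Submodule F (Fin n → F), IsQuaternaryHermitianLCD C k' d' := by
  obtain ⟨m, hm, hmp⟩ := List.mem_map.1 h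
  exact exists_of_check hω hL (List.all_eq_true.1 hM m hm) hmp.symm

end Certification

/-- The parameters of all derived codes. -/
def allParams : List (ℕ × ℕ × ℕ) :=
  (members_17_13_3.map fun m => m.params parity_17_13_3 3) ++
  (members_29_23_4.map fun m => m.params parity_29_23_4 4) ++
  (members_30_23_5.map fun m => m.params parity_30_23_5 5) ++
  (members_30_21_6.map fun m => m.params parity_30_21_6 6) ++
  (members_30_19_7.map fun m => m.params parity_30_19_7 7) ++
  (members_30_17_8.map fun m => m.params parity_30_17_8 8) ++
  (members_30_16_9.map fun m => m.params parity_30_16_9 9) ++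
  (members_30_10_14.map fun m => m.params parity_30_10_14 14) ++
  (members_30_8_15.map fun m => m.params parity_30_8_15 15) ++
  (members_30_6_18.map fun m => m.params parity_30_6_18 18) ++
  (members_30_5_19.map fun m => m.params parity_30_5_19 19) ++
  (members_26_4_17.map fun m => m.params parity_26_4_17 17)

theorem mem_allParams : ∀ t ∈ paramsOne ++ paramsTwo, t ∈ allParams := by
  decide +kernel

end QuaternaryLCD

open QuaternaryLCD in
theorem proposition5p2 (F : Type*) [Field F] [Fintype F] [DecidableEq F]
    (hF : Fintype.card F = 4) (n k d : ℕ)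
    (h : (n, k, d) ∈ QuaternaryLCD.paramsOne ∨ (n, k, d) ∈ QuaternaryLCD.paramsTwo) :
    (∃ C : Submodule F (Fin n → F), QuaternaryLCD.IsQuaternaryHermitianLCD C k d) ∧
      d ≤ QuaternaryLCD.d4 F n k := by
  obtain ⟨ω, hω⟩ := exists_isOmega hF
  suffices hC : ∃ C : Submodule F (Fin n → F), IsQuaternaryHermitianLCD C k d from
    ⟨hC, hC.elim fun _ => le_d4⟩
  have hmem := mem_allParams _ (List.mem_append.2 h)
  simp only [allParams, List.mem_append, or_assoc] at hmem
  rcases hmem with h | h | h | h | h | h | h | h | h | h | h | h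
  · exact exists_of_mem_params hω (minWeightGE_17_13_3 hω) check_17_13_3 h
  · exact exists_of_mem_params hω (minWeightGE_29_23_4 hω) check_29_23_4 h
  · exact exists_of_mem_params hω (minWeightGE_30_23_5 hω) check_30_23_5 h
  · exact exists_of_mem_params hω (minWeightGE_30_21_6 hω) check_30_21_6 h
  · exact exists_of_mem_params hω (minWeightGE_30_19_7 hω) check_30_19_7 h
  · exact exists_of_mem_params hω (minWeightGE_30_17_8 hω) check_30_17_8 h
  · exact exists_of_mem_params hω (minWeightGE_30_16_9 hω) check_30_16_9 h
  · exact exists_of_mem_params hω (minWeightGE_30_10_14 hω) check_30_10_14 h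
  · exact exists_of_mem_params hω (minWeightGE_30_8_15 hω) check_30_8_15 h
  · exact exists_of_mem_params hω (minWeightGE_30_6_18 hω) check_30_6_18 h
  · exact exists_of_mem_params hω (minWeightGE_30_5_19 hω) check_30_5_19 h
  · exact exists_of_mem_params hω (minWeightGE_26_4_17 hω) check_26_4_17 h
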